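/- Let $m\ge 1$, let $A_1,\dots,A_m$ be positive definite $n\times n$ complex matrices, and let $w=(w_1,\dots,w_m)$ be a weight vector, i.e. $w_j>0$ and $\sum_j w_j=1$. For positive definite matrices $A,B$ let $$d(A,B)=\bigl[\operatorname{tr}A+\operatorname{tr}B-2\operatorname{tr}(A^{1/2}BA^{1/2})^{1/2}\bigr]^{1/2},\qquad A\#B=A^{1/2}(A^{-1/2}BA^{-1/2})^{1/2}A^{1/2}$$ be their Bures–Wasserstein distance and their geometric mean. The function $X\mapsto\sum_{j=1}^m w_j\,d^2(X,A_j)$ on the positive definite matrices has a unique minimiser, the Wasserstein barycentre $\Omega=\Omega(w;A_1,\dots,A_m)$. Put $R_j=\Omega^{-1}\#A_j$ for $1\le j\le m$. Consider all $m$-tuples $(x_1,\dots,x_m)$ of square-integrable random vectors in $\mathbb{C}^n$, defined on a common probability space (which is allowed to vary), such that each $x_j$ has mean zero and covariance matrix $E[x_jx_j^*]=A_j$. Over all such tuples, $$\max\,E\Bigl\|\sum_{j=1}^m w_jx_j\Bigr\|^2=\operatorname{tr}\,\Omega(w;A_1,\dots,A_m).$$ The maximum is attained at every $m$-tuple $$(x_1,\;R_2R_1^{-1}x_1,\;R_3R_1^{-1}x_1,\;\dots,\;R_mR_1^{-1}x_1),$$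 where $x_1$ is an arbitrary random vector with mean zero and covariance matrix $A_1$; in particular $R_jR_1^{-1}x_1$ has mean zero and covariance matrix $A_j$ for every $j$. -/

import Mathlib

open MeasureTheory
open scoped MatrixOrder ComplexOrder

universe u

noncomputable section

namespace MCoupling

/-- The Bures–Wasserstein distance
`d(A, B) = [tr A + tr B - 2 tr (A^{1/2} B A^{1/2})^{1/2}]^{1/2}` between psd matrices;
`CFC.sqrt` is the psd square root. The traces are real for psd arguments. -/
def bwDist {n : ℕ} (A B : Matrix (Fin n) (Fin n) ℂ) : ℝ :=
  Real.sqrt (A.trace.re + B.trace.re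
    - 2 * (CFC.sqrt (CFC.sqrt A * B * CFC.sqrt A)).trace.re)

/-- The geometric mean `A # B = A^{1/2} (A^{-1/2} B A^{-1/2})^{1/2} A^{1/2}` of positive definite
matrices. -/
def geometricMean {n : ℕ} (A B : Matrix (Fin n) (Fin n) ℂ) : Matrix (Fin n) (Fin n) ℂ :=
  CFC.sqrt A * CFC.sqrt ((CFC.sqrt A)⁻¹ * B * (CFC.sqrt A)⁻¹) * CFC.sqrt A

/-- `X` is a minimiser of `Y ↦ ∑ j, w j * d(Y, A j)^2` over the positive definite matrices. -/
def IsWassersteinBarycenter {n m : ℕ} (w : Fin m → ℝ) (A : Fin m → Matrix (Fin n) (Fin n) ℂ)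
    (X : Matrix (Fin n) (Fin n) ℂ) : Prop :=
  X.PosDef ∧ ∀ Y : Matrix (Fin n) (Fin n) ℂ, Y.PosDef →
    ∑ j, w j * bwDist X (A j) ^ 2 ≤ ∑ j, w j * bwDist Y (A j) ^ 2

/-- The Wasserstein barycentre `Ω(w; A_1, …, A_m)`: the minimiser of
`Y ↦ ∑ j, w j * d(Y, A j)^2` over the positive definite matrices (an arbitrary matrix if there is
no minimiser). -/
def wassersteinBarycenter {n m : ℕ} (w : Fin m → ℝ) (A : Fin m → Matrix (Fin n) (Fin n) ℂ) :
    Matrix (Fin n) (Fin n) ℂ :=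
  Classical.epsilon (IsWassersteinBarycenter w A)

/-- `x` is a random vector in `ℂⁿ` on `(S, P)` with finite second moment, with mean zero and with
covariance matrix `A = E[x x*]`. -/
structure IsCenteredWithCov {n : ℕ} {S : Type*} [MeasurableSpace S] (P : Measure S)
    (A : Matrix (Fin n) (Fin n) ℂ) (x : S → EuclideanSpace ℂ (Fin n)) : Prop where
  memLp : MemLp x 2 P
  mean : ∫ s, x s ∂P = 0
  cov : ∀ i k : Fin n, ∫ s, x s i * star (x s k) ∂P = A i k

/-- `R_j = Ω⁻¹ # A_j`, where `Ω = Ω(w; A_1, …, A_m)`. -/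
def transportFactor {n m : ℕ} (w : Fin m → ℝ) (A : Fin m → Matrix (Fin n) (Fin n) ℂ)
    (j : Fin m) : Matrix (Fin n) (Fin n) ℂ :=
  geometricMean (wassersteinBarycenter w A)⁻¹ (A j)

/-- `E ‖∑ j, w j • x j‖²`. -/
def weightedSumEnergy {n m : ℕ} {S : Type*} [MeasurableSpace S] (P : Measure S) (w : Fin m → ℝ)
    (x : Fin m → S → EuclideanSpace ℂ (Fin n)) : ℝ :=
  ∫ s, ‖∑ j, (w j : ℂ) • x j s‖ ^ 2 ∂P

end MCoupling

end

namespace MCoupling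

open Matrix

variable {n m : ℕ}

/-! Everything rests on a dual description of the fidelity `F(A, B)`, the trace term in `d²`: `2
F(A, B) ≤ tr(RA) + tr(R⁻¹B)` for every positive definite `R`, with equality exactly at `R = A⁻¹ #
B`, which satisfies `R A R = B` (`two_mul_fidelity_le`, `eq_geometricMean_of_two_mul_fidelity_eq`).

Barycentre: let `T` be the weighted mean of the transport maps `X⁻¹ # A_j`. Replacing `X` by `T X T`
lowers the objective by at least `tr((1 - T) X (1 - T))`, and all such `T X T` lie in one compact
set of positive definite matrices. A minimiser on that set therefore has `T = 1`. Conversely, if `∑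
w_j R_j = 1`, the dual bounds with these `R_j` add up to a constant independent of the point, so `X`
is a global minimiser; equality in one of them gives uniqueness.

Coupling: the same `R_j` certify the upper bound. Young's inequality gives `‖∑ w_j x_j‖² ≤ ∑ w_j
x_j* R_j⁻¹ x_j`, with expectation `∑ w_j tr(R_j⁻¹ A_j) = tr Ω`. For the stated tuples `∑ w_j x_j =
R_1⁻¹ x_1`, whose covariance is `Ω`. -/

lemma posDef_sqrt {A : Matrix (Fin n) (Fin n) ℂ} (hA : A.PosDef) : (CFC.sqrt A).PosDef :=
  isStrictlyPositive_iff_posDef.1 (IsStrictlyPositive.sqrt A (isStrictlyPositive_iff_posDef.2 hA))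

lemma sqrt_mul_sqrt {A : Matrix (Fin n) (Fin n) ℂ} (hA : A.PosDef) :
    CFC.sqrt A * CFC.sqrt A = A :=
  CFC.sqrt_mul_sqrt_self A hA.posSemidef.nonneg

lemma posDef_conj {A R : Matrix (Fin n) (Fin n) ℂ} (hA : A.PosDef) (hR : R.PosDef) :
    (R * A * R).PosDef := by
  have h := (Matrix.IsUnit.posDef_star_left_conjugate_iff hR.isUnit).2 hA
  rwa [star_eq_conjTranspose, hR.isHermitian.eq] at h

lemma isUnit_det {A : Matrix (Fin n) (Fin n) ℂ} (hA : A.PosDef) : IsUnit A.det :=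
  (Matrix.isUnit_iff_isUnit_det A).1 hA.isUnit

lemma exists_eq_conjTranspose_mul {A : Matrix (Fin n) (Fin n) ℂ} (hA : A.PosSemidef) :
    ∃ D : Matrix (Fin n) (Fin n) ℂ, A = Dᴴ * D := by
  refine ⟨CFC.sqrt A, ?_⟩
  have h : (CFC.sqrt A).PosSemidef := nonneg_iff_posSemidef.1 (CFC.sqrt_nonneg A)
  rw [h.isHermitian.eq, CFC.sqrt_mul_sqrt_self A hA.nonneg]

lemma trace_re_nonneg {A : Matrix (Fin n) (Fin n) ℂ} (hA : A.PosSemidef) : 0 ≤ A.trace.re :=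
  (Complex.le_def.1 hA.trace_nonneg).1

lemma eq_zero_of_trace_re {A : Matrix (Fin n) (Fin n) ℂ} (hA : A.PosSemidef)
    (h : A.trace.re = 0) : A = 0 := by
  have h0 : A.trace = 0 :=
    Complex.ext h (Complex.le_def.1 hA.trace_nonneg).2.symm
  obtain ⟨D, rfl⟩ := exists_eq_conjTranspose_mul hA
  rw [trace_conjTranspose_mul_self_eq_zero_iff] at h0
  simp [h0]

lemma trace_mul_re_nonneg {A B : Matrix (Fin n) (Fin n) ℂ} (hA : A.PosSemidef)
    (hB : B.PosSemidef) : 0 ≤ (A * B).trace.re := by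
  obtain ⟨D, rfl⟩ := exists_eq_conjTranspose_mul hB
  rw [← mul_assoc, trace_mul_comm, ← mul_assoc]
  exact trace_re_nonneg (hA.mul_mul_conjTranspose_same D)

lemma eq_zero_of_trace_mul_re {A B : Matrix (Fin n) (Fin n) ℂ} (hA : A.PosSemidef)
    (hB : B.PosDef) (h : (A * B).trace.re = 0) : A = 0 := by
  have hS := posDef_sqrt hB
  have h1 : (CFC.sqrt B * A * CFC.sqrt B).PosSemidef := by
    have := hA.mul_mul_conjTranspose_same (CFC.sqrt B)
    rwa [hS.isHermitian.eq] at this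
  have h2 : CFC.sqrt B * A * CFC.sqrt B = 0 := by
    refine eq_zero_of_trace_re h1 ?_
    rw [trace_mul_comm, ← mul_assoc, sqrt_mul_sqrt hB, trace_mul_comm, h]
  have h3 := hS.isUnit.mul_left_eq_zero.1 h2
  exact hS.isUnit.mul_right_eq_zero.1 h3

/-! ### Geometric mean and Riccati equation -/

lemma posDef_geometricMean {A B : Matrix (Fin n) (Fin n) ℂ} (hA : A.PosDef) (hB : B.PosDef) :
    (geometricMean A B).PosDef :=
  posDef_conj (posDef_sqrt (posDef_conj hB (posDef_sqrt hA).inv)) (posDef_sqrt hA)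

lemma geometricMean_inv {A : Matrix (Fin n) (Fin n) ℂ} (hA : A.PosDef)
    (B : Matrix (Fin n) (Fin n) ℂ) : geometricMean A⁻¹ B =
      (CFC.sqrt A)⁻¹ * CFC.sqrt (CFC.sqrt A * B * CFC.sqrt A) * (CFC.sqrt A)⁻¹ := by
  rw [geometricMean, ← hA.posSemidef.inv_sqrt,
    nonsing_inv_nonsing_inv _ (isUnit_det (posDef_sqrt hA))]

lemma riccati_of_mul_self {P Q B : Matrix (Fin n) (Fin n) ℂ} (hd : IsUnit P.det)
    (h : Q * Q = P * B * P) : P⁻¹ * Q * P⁻¹ * (P * P) * (P⁻¹ * Q * P⁻¹) = B :=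
  calc P⁻¹ * Q * P⁻¹ * (P * P) * (P⁻¹ * Q * P⁻¹)
      = P⁻¹ * Q * (P⁻¹ * P) * (P * P⁻¹) * Q * P⁻¹ := by simp only [mul_assoc]
    _ = P⁻¹ * (Q * Q) * P⁻¹ := by
        rw [nonsing_inv_mul _ hd, mul_nonsing_inv _ hd]; simp only [mul_assoc, mul_one]
    _ = (P⁻¹ * P) * B * (P * P⁻¹) := by rw [h]; simp only [mul_assoc]
    _ = B := by rw [nonsing_inv_mul _ hd, mul_nonsing_inv _ hd, one_mul, mul_one]

/-- The Riccati equation for the geometric mean. -/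
lemma geometricMean_inv_mul_mul {A B : Matrix (Fin n) (Fin n) ℂ} (hA : A.PosDef)
    (hB : B.PosDef) : geometricMean A⁻¹ B * A * geometricMean A⁻¹ B = B := by
  have hP := posDef_sqrt hA
  have h := riccati_of_mul_self (isUnit_det hP) (sqrt_mul_sqrt (posDef_conj hB hP))
  rwa [sqrt_mul_sqrt hA, ← geometricMean_inv hA] at h

/-- The fidelity `tr (A^{1/2} B A^{1/2})^{1/2}`. -/
noncomputable def fidelity (A B : Matrix (Fin n) (Fin n) ℂ) : ℝ :=
  (CFC.sqrt (CFC.sqrt A * B * CFC.sqrt A)).trace.re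

lemma fidelity_eq_trace {A : Matrix (Fin n) (Fin n) ℂ} (hA : A.PosDef)
    (B : Matrix (Fin n) (Fin n) ℂ) : fidelity A B = (geometricMean A⁻¹ B * A).trace.re := by
  have hd := isUnit_det (posDef_sqrt hA)
  have h : ∀ P Q : Matrix (Fin n) (Fin n) ℂ, IsUnit P.det →
      (P⁻¹ * Q * P⁻¹ * (P * P)).trace = Q.trace := fun P Q hP => by
    rw [← mul_assoc, mul_assoc _ P⁻¹ P, nonsing_inv_mul _ hP, mul_one, trace_mul_comm, ← mul_assoc,
      mul_nonsing_inv _ hP, one_mul]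
  have h1 := h (CFC.sqrt A) (CFC.sqrt (CFC.sqrt A * B * CFC.sqrt A)) hd
  rw [sqrt_mul_sqrt hA, ← geometricMean_inv hA] at h1
  rw [h1, fidelity]

/-! ### Variational formula for the fidelity -/

lemma posSemidef_conj_hermitian {A C : Matrix (Fin n) (Fin n) ℂ} (hA : A.PosSemidef)
    (hC : C.IsHermitian) : (C * A * C).PosSemidef := by
  have := hA.mul_mul_conjTranspose_same C
  rwa [hC.eq] at this

/-- With `S = A⁻¹ # B` the right side becomes the gap in `2 F(A, B) ≤ tr(RA) + tr(R⁻¹B)`; the left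
side shows that it is nonnegative and vanishes only at `R = S`. -/
lemma trace_excess_eq {A R S : Matrix (Fin n) (Fin n) ℂ} (hR : R.PosDef) :
    ((R - S) * R⁻¹ * (R - S) * A).trace.re =
      (R * A).trace.re + (R⁻¹ * (S * A * S)).trace.re - 2 * (S * A).trace.re := by
  have hd := isUnit_det hR
  have h : (R - S) * R⁻¹ * (R - S) * A = R * A - S * A - S * A + S * (R⁻¹ * (S * A)) := by
    rw [sub_mul R S R⁻¹, mul_nonsing_inv _ hd, mul_sub, sub_mul, sub_mul 1, sub_mul, sub_mul,
      one_mul, mul_assoc S R⁻¹ R, nonsing_inv_mul _ hd, mul_one, one_mul]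
    simp only [sub_mul, mul_assoc]
    abel
  rw [h, trace_add, trace_sub, trace_sub, trace_mul_comm S (R⁻¹ * (S * A))]
  simp only [Complex.add_re, Complex.sub_re, mul_assoc]
  ring

lemma two_mul_fidelity_le {A B R : Matrix (Fin n) (Fin n) ℂ} (hA : A.PosDef) (hB : B.PosDef)
    (hR : R.PosDef) : 2 * fidelity A B ≤ (R * A).trace.re + (R⁻¹ * B).trace.re := by
  have hS := posDef_geometricMean hA.inv hB
  have h := trace_excess_eq (A := A) (S := geometricMean A⁻¹ B) hR
  rw [geometricMean_inv_mul_mul hA hB, ← fidelity_eq_trace hA] at h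
  have := trace_mul_re_nonneg (posSemidef_conj_hermitian hR.inv.posSemidef
    (hR.isHermitian.sub hS.isHermitian)) hA.posSemidef
  linarith

lemma eq_geometricMean_of_two_mul_fidelity_eq {A B R : Matrix (Fin n) (Fin n) ℂ}
    (hA : A.PosDef) (hB : B.PosDef) (hR : R.PosDef)
    (h : 2 * fidelity A B = (R * A).trace.re + (R⁻¹ * B).trace.re) :
    R = geometricMean A⁻¹ B := by
  have hS := posDef_geometricMean hA.inv hB
  have h1 := trace_excess_eq (A := A) (S := geometricMean A⁻¹ B) hR
  rw [geometricMean_inv_mul_mul hA hB, ← fidelity_eq_trace hA] at h1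
  have hH := hR.isHermitian.sub hS.isHermitian
  have h2 := eq_zero_of_trace_mul_re (posSemidef_conj_hermitian hR.inv.posSemidef hH) hA
    (by linarith)
  rw [← sub_eq_zero, ← trace_conjTranspose_mul_self_eq_zero_iff, hH.eq]
  have h3 := eq_zero_of_trace_mul_re (A := (R - geometricMean A⁻¹ B) * (R - geometricMean A⁻¹ B))
    (B := R⁻¹) (by simpa only [mul_one] using posSemidef_conj_hermitian PosSemidef.one hH) hR.inv
    (by rw [mul_assoc, trace_mul_comm, h2, trace_zero, Complex.zero_re])
  rw [h3, trace_zero]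

lemma two_mul_fidelity_eq {A B : Matrix (Fin n) (Fin n) ℂ} (hA : A.PosDef) (hB : B.PosDef) :
    2 * fidelity A B =
      (geometricMean A⁻¹ B * A).trace.re + ((geometricMean A⁻¹ B)⁻¹ * B).trace.re := by
  have hS := posDef_geometricMean hA.inv hB
  have h := trace_excess_eq (A := A) (S := geometricMean A⁻¹ B) hS
  rw [geometricMean_inv_mul_mul hA hB, ← fidelity_eq_trace hA] at h
  simp only [sub_self, zero_mul, trace_zero, Complex.zero_re] at h
  rw [← fidelity_eq_trace hA]
  linarith

lemma trace_re_conjTranspose (A : Matrix (Fin n) (Fin n) ℂ) : Aᴴ.trace.re = A.trace.re := by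
  rw [trace_conjTranspose]; rfl

/-- If `x` has covariance `X`, then `(Tx, Rx)` couples the two arguments of the fidelity, and no
coupling correlates better than the fidelity. The proof pairs a square with `X`, using the optimal
factor `S` between the two covariances. -/
lemma trace_mul_mul_re_le_fidelity {X T R : Matrix (Fin n) (Fin n) ℂ} (hX : X.PosDef)
    (hT : T.PosDef) (hR : R.PosDef) :
    (T * X * R).trace.re ≤ fidelity (T * X * T) (R * X * R) := by
  have hA := posDef_conj hX hT
  have hB := posDef_conj hX hR
  have hS := posDef_geometricMean hA.inv hB
  have hF := two_mul_fidelity_eq hA hB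
  generalize geometricMean (T * X * T)⁻¹ (R * X * R) = S at *
  have hd := isUnit_det hS
  have h1 : (T * S - R) * S⁻¹ * (T * S - R)ᴴ =
      T * S * T - T * R - R * T + R * S⁻¹ * R := by
    rw [conjTranspose_sub, conjTranspose_mul, hT.isHermitian.eq, hS.isHermitian.eq,
      hR.isHermitian.eq, sub_mul (T * S), mul_assoc T S S⁻¹, mul_nonsing_inv _ hd, mul_one,
      sub_mul, mul_sub, mul_sub, ← mul_assoc, ← mul_assoc (R * S⁻¹), mul_assoc R S⁻¹ S,
      nonsing_inv_mul _ hd, mul_one]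
    abel
  have h2 := trace_mul_re_nonneg (hS.inv.posSemidef.mul_mul_conjTranspose_same (T * S - R))
    hX.posSemidef
  rw [h1] at h2
  simp only [add_mul, sub_mul, trace_add, trace_sub, Complex.add_re, Complex.sub_re] at h2
  have e1 : (T * S * T * X).trace = (S * (T * X * T)).trace := by
    rw [mul_assoc, mul_assoc, trace_mul_comm T]; simp only [mul_assoc]
  have e2 : (R * S⁻¹ * R * X).trace = (S⁻¹ * (R * X * R)).trace := by
    rw [mul_assoc, mul_assoc, trace_mul_comm R]; simp only [mul_assoc]
  have e3 : (R * T * X).trace = (T * X * R).trace := by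
    rw [mul_assoc, trace_mul_comm R]
  have e4 : (T * R * X).trace.re = (T * X * R).trace.re := by
    rw [← trace_re_conjTranspose, ← e3]
    simp only [conjTranspose_mul, hT.isHermitian.eq, hX.isHermitian.eq, hR.isHermitian.eq]
    rw [trace_mul_comm]
  rw [e1, e2, e3, e4] at h2
  linarith

lemma bwDist_sq {A B : Matrix (Fin n) (Fin n) ℂ} (hA : A.PosDef) (hB : B.PosDef) :
    bwDist A B ^ 2 = A.trace.re + B.trace.re - 2 * fidelity A B := by
  refine Real.sq_sqrt ?_
  -- The choice `R = 1` shows that the radicand is nonnegative, so `Real.sqrt` does not truncate.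
  have := two_mul_fidelity_le hA hB PosDef.one
  simp only [inv_one, one_mul] at this
  exact sub_nonneg.2 this

/-! ### Monotonicity of the determinant -/

lemma one_le_det_re {C : Matrix (Fin n) (Fin n) ℂ} (hC : C.PosSemidef) :
    1 ≤ (1 + C).det.re := by
  have hH : (1 + C).IsHermitian := (PosSemidef.one.add hC).isHermitian
  have h : (1 + C).det = ((∏ i, hH.eigenvalues i : ℝ) : ℂ) := by
    rw [hH.det_eq_prod_eigenvalues]; push_cast; rfl
  rw [h, Complex.ofReal_re]
  refine Finset.one_le_prod fun i _ => ?_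
  have h1 := hH.eigenvalues_mem_spectrum_real i
  have h2 : hH.eigenvalues i - 1 ∈ spectrum ℝ C := by
    have := spectrum.add_mem_add_iff (R := ℝ) (r := hH.eigenvalues i - 1) (s := 1) (a := C)
    rw [← this]
    simpa using h1
  have h3 := (posSemidef_iff_isHermitian_and_spectrum_nonneg.1 hC).2
  have h4 := h3 (spectrum.algebraMap_mem ℂ h2)
  have h5 := (Complex.le_def.1 h4).1
  simpa using h5

lemma det_re_le_det_add_re {P C : Matrix (Fin n) (Fin n) ℂ} (hP : P.PosDef)
    (hC : C.PosSemidef) : P.det.re ≤ (P + C).det.re := by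
  have hS := posDef_sqrt hP
  have hSS := sqrt_mul_sqrt hP
  generalize CFC.sqrt P = S at *
  have hd := isUnit_det hS
  have h1 : P + C = S * (1 + S⁻¹ * C * S⁻¹) * S := by
    rw [mul_add, add_mul, mul_one, hSS]
    congr 1
    calc C = (S * S⁻¹) * C * (S⁻¹ * S) := by
          rw [nonsing_inv_mul _ hd, mul_nonsing_inv _ hd, one_mul, mul_one]
      _ = _ := by simp only [mul_assoc]
  have h2 : (P + C).det = P.det * (1 + S⁻¹ * C * S⁻¹).det := by
    rw [h1, det_mul, det_mul, ← hSS, det_mul]; ring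
  have h3 := one_le_det_re (posSemidef_conj_hermitian hC hS.inv.isHermitian)
  have h4 := Complex.lt_def.1 hP.det_pos
  rw [h2, Complex.mul_re, ← h4.2]
  simp only [Complex.zero_re, Complex.zero_im] at *
  nlinarith [h4.1]

lemma det_im_eq_zero {P : Matrix (Fin n) (Fin n) ℂ} (hP : P.PosDef) : P.det.im = 0 :=
  (Complex.lt_def.1 hP.det_pos).2.symm

lemma det_re_pos {P : Matrix (Fin n) (Fin n) ℂ} (hP : P.PosDef) : 0 < P.det.re :=
  (Complex.lt_def.1 hP.det_pos).1

end MCoupling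

/-! ### Existence of a matrix with mean transport 1 -/

namespace MCoupling

open Matrix Topology

variable {n m : ℕ}

/-- The objective function of the barycentre problem. -/
noncomputable def objective (w : Fin m → ℝ) (A : Fin m → Matrix (Fin n) (Fin n) ℂ)
    (X : Matrix (Fin n) (Fin n) ℂ) : ℝ :=
  ∑ j, w j * bwDist X (A j) ^ 2

/-- The average of the optimal transport maps from `X` to the `A j`. -/
noncomputable def meanTransport (w : Fin m → ℝ) (A : Fin m → Matrix (Fin n) (Fin n) ℂ)
    (X : Matrix (Fin n) (Fin n) ℂ) : Matrix (Fin n) (Fin n) ℂ :=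
  ∑ j, w j • geometricMean X⁻¹ (A j)

variable {w : Fin m → ℝ} {A : Fin m → Matrix (Fin n) (Fin n) ℂ}

lemma posDef_meanTransport [NeZero m] (hw : ∀ j, 0 < w j) (hA : ∀ j, (A j).PosDef)
    {X : Matrix (Fin n) (Fin n) ℂ} (hX : X.PosDef) : (meanTransport w A X).PosDef :=
  posDef_sum ⟨0, Finset.mem_univ _⟩
    fun j _ => (posDef_geometricMean hX.inv (hA j)).smul (hw j)

lemma trace_sum_smul_mul_re (w : Fin m → ℝ) (R : Fin m → Matrix (Fin n) (Fin n) ℂ)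
    (B : Matrix (Fin n) (Fin n) ℂ) :
    ((∑ j, w j • R j) * B).trace.re = ∑ j, w j * (R j * B).trace.re := by
  simp [Finset.sum_mul, trace_sum, trace_smul]

lemma objective_eq (hA : ∀ j, (A j).PosDef) {X : Matrix (Fin n) (Fin n) ℂ} (hX : X.PosDef) :
    objective w A X = ∑ j, w j * (X.trace.re + (A j).trace.re - 2 * fidelity X (A j)) :=
  Finset.sum_congr rfl fun j _ => by rw [bwDist_sq hX (hA j)]

lemma le_objective (hw : ∀ j, 0 < w j) (hA : ∀ j, (A j).PosDef)
    {X : Matrix (Fin n) (Fin n) ℂ} (hX : X.PosDef) {R : Fin m → Matrix (Fin n) (Fin n) ℂ}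
    (hR : ∀ j, (R j).PosDef) :
    ∑ j, w j * (X.trace.re + (A j).trace.re -
      ((R j * X).trace.re + ((R j)⁻¹ * A j).trace.re)) ≤ objective w A X := by
  rw [objective_eq hA hX]
  exact Finset.sum_le_sum fun j _ => mul_le_mul_of_nonneg_left
    (sub_le_sub_left (two_mul_fidelity_le hX (hA j) (hR j)) _) (hw j).le

lemma objective_eq_of_geometricMean (hA : ∀ j, (A j).PosDef) {X : Matrix (Fin n) (Fin n) ℂ}
    (hX : X.PosDef) : objective w A X = ∑ j, w j * (X.trace.re + (A j).trace.re -
      ((geometricMean X⁻¹ (A j) * X).trace.re +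
        ((geometricMean X⁻¹ (A j))⁻¹ * A j).trace.re)) := by
  rw [objective_eq hA hX]
  exact Finset.sum_congr rfl fun j _ => by rw [two_mul_fidelity_eq hX (hA j)]

/-- The optimal factors at a point `X₀` give an affine minorant of the objective that touches it at
`X₀`. This avoids proving continuity of the matrix square root. -/
lemma lowerSemicontinuousOn_objective (hw : ∀ j, 0 < w j) (hA : ∀ j, (A j).PosDef)
    {K : Set (Matrix (Fin n) (Fin n) ℂ)} (hK : ∀ X ∈ K, X.PosDef) :
    LowerSemicontinuousOn (objective w A) K := by
  intro X₀ hX₀ y hy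
  have h0 := hK X₀ hX₀
  rw [objective_eq_of_geometricMean hA h0] at hy
  have hc : Continuous fun X : Matrix (Fin n) (Fin n) ℂ => ∑ j, w j * (X.trace.re +
      (A j).trace.re - ((geometricMean X₀⁻¹ (A j) * X).trace.re +
        ((geometricMean X₀⁻¹ (A j))⁻¹ * A j).trace.re)) := by
    have ht : Continuous fun X : Matrix (Fin n) (Fin n) ℂ => X.trace :=
      continuous_id.matrix_trace
    have hm : ∀ j, Continuous fun X : Matrix (Fin n) (Fin n) ℂ =>
        (geometricMean X₀⁻¹ (A j) * X).trace := fun j =>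
      (continuous_const.matrix_mul continuous_id).matrix_trace
    refine continuous_finsetSum _ fun j _ => continuous_const.mul ?_
    exact ((Complex.continuous_re.comp ht).add continuous_const).sub
      ((Complex.continuous_re.comp (hm j)).add continuous_const)
  filter_upwards [(hc.continuousAt.eventually (lt_mem_nhds hy)).filter_mono nhdsWithin_le_nhds,
    self_mem_nhdsWithin] with X hX hXK
  exact hX.trans_le
    (le_objective hw hA (hK X hXK) fun j => posDef_geometricMean h0.inv (hA j))

/-- The images under `D ↦ Dᴴ * D` of a closed bounded set of matrices. -/
lemma isCompact_setOf_gram (c d : ℝ) :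
    IsCompact ((fun D : Matrix (Fin n) (Fin n) ℂ => Dᴴ * D) '' {D |
      -- The entrywise bound makes the set of `D` bounded; it follows from the trace bound by
      -- `norm_apply_le_sqrt_trace`.
      (∀ i j, ‖D i j‖ ≤ Real.sqrt c) ∧ (Dᴴ * D).trace.re ≤ c ∧ d ≤ (Dᴴ * D).det.re}) := by
  have hg : Continuous fun D : Matrix (Fin n) (Fin n) ℂ => Dᴴ * D :=
    continuous_id.matrix_conjTranspose.matrix_mul continuous_id
  refine IsCompact.image ?_ hg
  have h1 : IsCompact {D : Matrix (Fin n) (Fin n) ℂ | ∀ i j, ‖D i j‖ ≤ Real.sqrt c} := by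
    have := isCompact_univ_pi (X := fun _ : Fin n => Fin n → ℂ) fun _ : Fin n =>
      isCompact_univ_pi (X := fun _ : Fin n => ℂ) fun _ : Fin n =>
        isCompact_closedBall (0 : ℂ) (Real.sqrt c)
    refine this.of_isClosed_subset ?_ fun D hD => by
      simpa [Set.mem_pi] using fun i j => hD i j
    simp only [Set.ofPred_forall]
    exact isClosed_iInter fun i => isClosed_iInter fun j => isClosed_le
      (continuous_norm.comp ((continuous_apply j).comp (continuous_apply i))) continuous_const
  refine h1.inter_right (IsClosed.inter ?_ ?_)
  · exact isClosed_le (Complex.continuous_re.comp hg.matrix_trace) continuous_const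
  · exact isClosed_le continuous_const (Complex.continuous_re.comp hg.matrix_det)

lemma norm_apply_le_sqrt_trace (D : Matrix (Fin n) (Fin n) ℂ) (i j : Fin n) :
    ‖D i j‖ ≤ Real.sqrt (Dᴴ * D).trace.re := by
  refine Real.le_sqrt_of_sq_le ?_
  have h : (Dᴴ * D).trace.re = ∑ l, ∑ k, ‖D k l‖ ^ 2 := by
    simp only [trace, diag_apply, mul_apply, conjTranspose_apply, Complex.re_sum]
    refine Finset.sum_congr rfl fun l _ => Finset.sum_congr rfl fun k _ => ?_
    rw [← Complex.normSq_eq_norm_sq, Complex.normSq_apply]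
    simp
  rw [h]
  calc ‖D i j‖ ^ 2 ≤ ∑ k, ‖D k j‖ ^ 2 :=
        Finset.single_le_sum (f := fun k => ‖D k j‖ ^ 2) (fun _ _ => sq_nonneg _)
          (Finset.mem_univ i)
    _ ≤ _ := Finset.single_le_sum (f := fun l => ∑ k, ‖D k l‖ ^ 2)
          (fun _ _ => Finset.sum_nonneg fun _ _ => sq_nonneg _) (Finset.mem_univ j)

lemma sum_weighted_affine (hw1 : ∑ j, w j = 1) (a : ℝ) (f g : Fin m → ℝ) :
    ∑ j, w j * (a + f j - 2 * g j) = a + ∑ j, w j * f j - 2 * ∑ j, w j * g j := by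
  simp only [mul_sub, mul_add, Finset.sum_sub_distrib, Finset.sum_add_distrib, ← Finset.sum_mul,
    hw1, one_mul, Finset.mul_sum, mul_left_comm]

/-- Nonnegativity of the variance: `∑ w_j tr((R_j - T) X (R_j - T)) ≥ 0`, where `T` is the mean of
the `R_j`. -/
lemma trace_mean_conj_le (hw : ∀ j, 0 < w j) (hw1 : ∑ j, w j = 1)
    {R : Fin m → Matrix (Fin n) (Fin n) ℂ} (hR : ∀ j, (R j).IsHermitian)
    {X : Matrix (Fin n) (Fin n) ℂ} (hX : X.PosSemidef) :
    ((∑ j, w j • R j) * X * (∑ j, w j • R j)).trace.re ≤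
      ∑ j, w j * (R j * X * R j).trace.re := by
  set T := ∑ j, w j • R j with hT
  have hTH : T.IsHermitian := by
    rw [hT, IsHermitian, conjTranspose_sum]
    exact Finset.sum_congr rfl fun j _ => by
      rw [conjTranspose_smul, (hR j).eq, star_trivial]
  have h1 : ∀ j, 0 ≤ (R j * X * R j).trace.re - 2 * (R j * (X * T)).trace.re
      + (T * X * T).trace.re := fun j => by
    have h := trace_re_nonneg (posSemidef_conj_hermitian hX ((hR j).sub hTH))
    have e : (R j - T) * X * (R j - T) =
        R j * X * R j - T * X * R j - R j * (X * T) + T * X * T := by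
      simp only [sub_mul, mul_sub, mul_assoc]; abel
    have e2 : (T * X * R j).trace.re = (R j * (X * T)).trace.re := by
      rw [← trace_re_conjTranspose]
      simp only [conjTranspose_mul, hTH.eq, hX.isHermitian.eq, (hR j).eq]
    rw [e] at h
    simp only [trace_add, trace_sub, Complex.add_re, Complex.sub_re, e2] at h
    linarith
  have h2 : 0 ≤ ∑ j, w j * ((R j * X * R j).trace.re - 2 * (R j * (X * T)).trace.re
      + (T * X * T).trace.re) :=
    Finset.sum_nonneg fun j _ => mul_nonneg (hw j).le (h1 j)
  have h3 := trace_sum_smul_mul_re w R (X * T)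
  rw [← hT, ← mul_assoc] at h3
  have h4 : ∑ j, w j * ((R j * X * R j).trace.re - 2 * (R j * (X * T)).trace.re
      + (T * X * T).trace.re) = (T * X * T).trace.re + ∑ j, w j * (R j * X * R j).trace.re
        - 2 * ∑ j, w j * (R j * (X * T)).trace.re := by
    rw [← sum_weighted_affine hw1]
    exact Finset.sum_congr rfl fun j _ => by ring
  rw [h4, ← h3] at h2
  linarith

/-- Bounding each fidelity at `T X T` below by `tr(R_j T X)` and summing gives at least `tr(T X T)`;
at `X` the weighted sum of fidelities is exactly `tr(T X)`. The difference completes a square. -/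
lemma objective_transport_le [NeZero m] (hw : ∀ j, 0 < w j) (hw1 : ∑ j, w j = 1)
    (hA : ∀ j, (A j).PosDef) {X T : Matrix (Fin n) (Fin n) ℂ} (hX : X.PosDef)
    (hT : T = meanTransport w A X) :
    objective w A (T * X * T) ≤ objective w A X - ((1 - T) * X * (1 - T)).trace.re := by
  have hTp : T.PosDef := hT ▸ posDef_meanTransport hw hA hX
  have hR := fun j => posDef_geometricMean hX.inv (hA j)
  have hRA := fun j => geometricMean_inv_mul_mul hX (hA j)
  rw [objective_eq hA hX, objective_eq hA (posDef_conj hX hTp)]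
  have h1 : ∀ j, (geometricMean X⁻¹ (A j) * (T * X)).trace.re ≤
      fidelity (T * X * T) (A j) := fun j => by
    have := trace_mul_mul_re_le_fidelity hX hTp (hR j)
    rwa [hRA, trace_mul_comm] at this
  have h2 := trace_sum_smul_mul_re w (fun j => geometricMean X⁻¹ (A j)) (T * X)
  have h3 := trace_sum_smul_mul_re w (fun j => geometricMean X⁻¹ (A j)) X
  rw [← meanTransport, ← hT] at h2 h3
  have h4 : ∑ j, w j * (geometricMean X⁻¹ (A j) * (T * X)).trace.re ≤
      ∑ j, w j * fidelity (T * X * T) (A j) :=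
    Finset.sum_le_sum fun j _ => mul_le_mul_of_nonneg_left (h1 j) (hw j).le
  have h5 : ((1 - T) * X * (1 - T)).trace.re =
      X.trace.re - 2 * (T * X).trace.re + (T * X * T).trace.re := by
    have e : (1 - T) * X * (1 - T) = X - T * X - X * T + T * X * T := by
      simp only [sub_mul, mul_sub, one_mul, mul_one]; abel
    rw [e, trace_add, trace_sub, trace_sub, trace_mul_comm X T]
    simp only [Complex.add_re, Complex.sub_re]; ring
  have h7 : ∑ j, w j * fidelity X (A j) = (T * X).trace.re := by
    rw [h3]
    exact Finset.sum_congr rfl fun j _ => by rw [fidelity_eq_trace hX]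
  have h8 : (T * (T * X)).trace.re = (T * X * T).trace.re := by
    rw [trace_mul_comm, mul_assoc]
  rw [sum_weighted_affine hw1, sum_weighted_affine hw1, h5, h7]
  linarith

lemma exists_meanTransport_eq_one [NeZero m] (hw : ∀ j, 0 < w j) (hw1 : ∑ j, w j = 1)
    (hA : ∀ j, (A j).PosDef) :
    ∃ X : Matrix (Fin n) (Fin n) ℂ, X.PosDef ∧ meanTransport w A X = 1 := by
  -- With `R_j X R_j = A_j`, convexity gives `tr(T X T) ≤ c`. Since `T` dominates `w_0 R_0`, `det T
  -- ≥ w_0ⁿ det R_0`, and squaring and multiplying by `det X` gives `det(T X T) ≥ d`.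
  set c := ∑ j, w j * (A j).trace.re with hc
  set d := (w 0 ^ n) ^ 2 * (A 0).det.re with hd
  have hdpos : 0 < d := mul_pos (pow_pos (pow_pos (hw 0) _) _) (det_re_pos (hA 0))
  set K := (fun D : Matrix (Fin n) (Fin n) ℂ => Dᴴ * D) '' {D |
      (∀ i j, ‖D i j‖ ≤ Real.sqrt c) ∧ (Dᴴ * D).trace.re ≤ c ∧ d ≤ (Dᴴ * D).det.re} with hKdef
  have hK : ∀ X ∈ K, X.PosDef := by
    rintro _ ⟨D, ⟨-, -, hD⟩, rfl⟩
    refine (posSemidef_conjTranspose_mul_self D).posDef_iff_det_ne_zero.2 fun h => ?_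
    rw [h] at hD
    simp only [Complex.zero_re] at hD
    linarith
  have hG : ∀ X : Matrix (Fin n) (Fin n) ℂ, X.PosDef →
      meanTransport w A X * X * meanTransport w A X ∈ K := fun X hX => by
    have hT := posDef_meanTransport hw hA hX
    have hR := fun j => posDef_geometricMean hX.inv (hA j)
    have htr : (meanTransport w A X * X * meanTransport w A X).trace.re ≤ c := by
      refine (trace_mean_conj_le hw hw1 (fun j => (hR j).isHermitian) hX.posSemidef).trans_eq ?_
      exact Finset.sum_congr rfl fun j _ => by rw [geometricMean_inv_mul_mul hX (hA j)]
    have hdet : d ≤ (meanTransport w A X * X * meanTransport w A X).det.re := by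
      have h0 := geometricMean_inv_mul_mul hX (hA 0)
      have hsplit : meanTransport w A X = w 0 • geometricMean X⁻¹ (A 0) +
          ∑ j ∈ Finset.univ.erase 0, w j • geometricMean X⁻¹ (A j) :=
        (Finset.add_sum_erase _ _ (Finset.mem_univ 0)).symm
      have hle := det_re_le_det_add_re ((hR 0).smul (hw 0)) (posSemidef_sum
        (x := fun j => w j • geometricMean X⁻¹ (A j)) (Finset.univ.erase 0)
        fun j _ => (hR j).posSemidef.smul (hw j).le)
      rw [← hsplit] at hle
      have hs : (w 0 • geometricMean X⁻¹ (A 0)).det.re =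
          w 0 ^ n * (geometricMean X⁻¹ (A 0)).det.re := by
        rw [← Complex.coe_smul, det_smul, Fintype.card_fin, ← Complex.ofReal_pow,
          Complex.re_ofReal_mul]
      rw [hs] at hle
      have hprod : ∀ P Q : Matrix (Fin n) (Fin n) ℂ, P.PosDef → Q.PosDef →
          (P * Q * P).det.re = P.det.re ^ 2 * Q.det.re := fun P Q hP hQ => by
        rw [det_mul, det_mul, Complex.mul_re, Complex.mul_re, det_im_eq_zero hP,
          det_im_eq_zero hQ]
        ring
      rw [hd, ← h0, hprod _ _ (hR 0) hX, hprod _ _ hT hX, ← mul_assoc, ← mul_pow]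
      exact mul_le_mul_of_nonneg_right (pow_le_pow_left₀
        (mul_nonneg (pow_nonneg (hw 0).le _) (det_re_pos (hR 0)).le) hle 2) (det_re_pos hX).le
    obtain ⟨D, hD⟩ := exists_eq_conjTranspose_mul (posDef_conj hX hT).posSemidef
    rw [hD] at htr hdet ⊢
    exact ⟨D, ⟨fun i j => (norm_apply_le_sqrt_trace D i j).trans (Real.sqrt_le_sqrt htr),
      htr, hdet⟩, rfl⟩
  obtain ⟨X, hXK, hXmin⟩ := (lowerSemicontinuousOn_objective hw hA hK).exists_isMinOn
    ⟨_, hG 1 PosDef.one⟩ (isCompact_setOf_gram c d)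
  have hX := hK X hXK
  refine ⟨X, hX, ?_⟩
  -- The image `T X T` lies in `K` again, so minimality of `X` on `K` forces the guaranteed decrease
  -- to vanish.
  have h1 := hXmin (hG X hX)
  have h2 := objective_transport_le hw hw1 hA hX rfl
  have hH := (posDef_meanTransport hw hA hX).isHermitian
  have hP := posSemidef_conj_hermitian hX.posSemidef (isHermitian_one.sub hH)
  have h3 := eq_zero_of_trace_re hP (le_antisymm (by
    have : objective w A X ≤ _ := h1
    linarith) (trace_re_nonneg hP))
  have h4 := eq_zero_of_trace_mul_re (B := X)
    (posSemidef_conj_hermitian PosSemidef.one (isHermitian_one.sub hH)) hX (by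
      rw [mul_one, mul_assoc, trace_mul_comm, h3, trace_zero, Complex.zero_re])
  rw [mul_one] at h4
  have h5 := trace_conjTranspose_mul_self_eq_zero_iff (A := 1 - meanTransport w A X)
  rw [(isHermitian_one.sub hH).eq, h4, trace_zero] at h5
  exact (sub_eq_zero.1 (h5.1 rfl)).symm

/-! ### Optimality and uniqueness of the barycentre -/

lemma sum_eq_of_meanTransport_eq_one (hw1 : ∑ j, w j = 1)
    {R : Fin m → Matrix (Fin n) (Fin n) ℂ} (hR : ∑ j, w j • R j = 1)
    (Y : Matrix (Fin n) (Fin n) ℂ) :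
    ∑ j, w j * (Y.trace.re + (A j).trace.re - ((R j * Y).trace.re + ((R j)⁻¹ * A j).trace.re)) =
      ∑ j, w j * ((A j).trace.re - ((R j)⁻¹ * A j).trace.re) := by
  have h := trace_sum_smul_mul_re w R Y
  rw [hR, one_mul] at h
  have h1 : ∑ j, w j * Y.trace.re = Y.trace.re := by rw [← Finset.sum_mul, hw1, one_mul]
  rw [← sub_eq_zero, ← Finset.sum_sub_distrib]
  rw [← sub_eq_zero.2 (h1.trans h), ← Finset.sum_sub_distrib]
  exact Finset.sum_congr rfl fun j _ => by ring

lemma isWassersteinBarycenter_of_meanTransport_eq_one (hw : ∀ j, 0 < w j)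
    (hw1 : ∑ j, w j = 1) (hA : ∀ j, (A j).PosDef) {X : Matrix (Fin n) (Fin n) ℂ}
    (hX : X.PosDef) (h : meanTransport w A X = 1) : IsWassersteinBarycenter w A X := by
  refine ⟨hX, fun Y hY => ?_⟩
  change objective w A X ≤ objective w A Y
  rw [objective_eq_of_geometricMean hA hX, sum_eq_of_meanTransport_eq_one hw1 h,
    ← sum_eq_of_meanTransport_eq_one hw1 h Y]
  exact le_objective hw hA hY fun j => posDef_geometricMean hX.inv (hA j)

lemma IsWassersteinBarycenter.eq_of_meanTransport_eq_one [NeZero m] (hw : ∀ j, 0 < w j)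
    (hw1 : ∑ j, w j = 1) (hA : ∀ j, (A j).PosDef) {X Y : Matrix (Fin n) (Fin n) ℂ}
    (hX : X.PosDef) (h : meanTransport w A X = 1) (hY : IsWassersteinBarycenter w A Y) :
    Y = X := by
  have hR := fun j => posDef_geometricMean hX.inv (hA j)
  have hle : ∀ j ∈ Finset.univ, w j * (Y.trace.re + (A j).trace.re -
      ((geometricMean X⁻¹ (A j) * Y).trace.re +
        ((geometricMean X⁻¹ (A j))⁻¹ * A j).trace.re)) ≤
      w j * (Y.trace.re + (A j).trace.re - 2 * fidelity Y (A j)) := fun j _ =>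
    mul_le_mul_of_nonneg_left
      (sub_le_sub_left (two_mul_fidelity_le hY.1 (hA j) (hR j)) _) (hw j).le
  have heq : ∑ j, w j * (Y.trace.re + (A j).trace.re -
      ((geometricMean X⁻¹ (A j) * Y).trace.re +
        ((geometricMean X⁻¹ (A j))⁻¹ * A j).trace.re)) =
      ∑ j, w j * (Y.trace.re + (A j).trace.re - 2 * fidelity Y (A j)) := by
    refine le_antisymm (Finset.sum_le_sum hle) ?_
    rw [← objective_eq hA hY.1, sum_eq_of_meanTransport_eq_one hw1 h,
      ← sum_eq_of_meanTransport_eq_one hw1 h X, ← objective_eq_of_geometricMean hA hX]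
    exact hY.2 X hX
  -- A sum of termwise inequalities that is an equality is an equality in each term. One index
  -- suffices: `R_0` is then optimal for `Y` too, so `R_0 Y R_0 = A_0 = R_0 X R_0`.
  have h0 := mul_left_cancel₀ (hw 0).ne'
    ((Finset.sum_eq_sum_iff_of_le hle).1 heq 0 (Finset.mem_univ 0))
  have h1 := eq_geometricMean_of_two_mul_fidelity_eq hY.1 (hA 0) (hR 0) (by linarith)
  have h2 := geometricMean_inv_mul_mul hY.1 (hA 0)
  rw [← h1] at h2
  have h3 := h2.trans (geometricMean_inv_mul_mul hX (hA 0)).symm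
  have hu := (hR 0).isUnit
  exact hu.mul_left_cancel (hu.mul_right_cancel h3)

end MCoupling

/-! ### Second moments and the upper bound for couplings -/

namespace MCoupling

open Matrix

variable {n m : ℕ} {S : Type*} [MeasurableSpace S] {P : Measure S}
  {A : Matrix (Fin n) (Fin n) ℂ} {x : S → EuclideanSpace ℂ (Fin n)}

lemma IsCenteredWithCov.integrable_mul_star (hx : IsCenteredWithCov P A x) (i k : Fin n) :
    Integrable (fun s => x s i * star (x s k)) P :=
  (MemLp.eval_piLp hx.memLp i).integrable_mul (MemLp.eval_piLp hx.memLp k).star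

/-- The covariance matrix of a linear image. -/
lemma IsCenteredWithCov.toEuclideanLin [IsFiniteMeasure P] (hx : IsCenteredWithCov P A x)
    (M : Matrix (Fin n) (Fin n) ℂ) :
    IsCenteredWithCov P (M * A * Mᴴ) fun s => Matrix.toEuclideanLin M (x s) where
  memLp := (LinearMap.toContinuousLinearMap (Matrix.toEuclideanLin M)).comp_memLp' hx.memLp
  mean := by
    have h := (LinearMap.toContinuousLinearMap (Matrix.toEuclideanLin M)).integral_comp_comm
      (hx.memLp.integrable one_le_two)
    rw [hx.mean, map_zero] at h
    exact h
  cov i k := by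
    have h : ∀ s, Matrix.toEuclideanLin M (x s) i * star (Matrix.toEuclideanLin M (x s) k) =
        ∑ a, ∑ b, M i a * star (M k b) * (x s a * star (x s b)) := fun s => by
      simp only [toLpLin_apply, mulVec, dotProduct, star_sum, star_mul',
        Finset.sum_mul_sum]
      exact Finset.sum_congr rfl fun a _ => Finset.sum_congr rfl fun b _ => by ring
    simp_rw [h]
    rw [integral_finsetSum _ fun a _ => integrable_finsetSum _ fun b _ =>
      (hx.integrable_mul_star a b).const_mul _]
    simp_rw [integral_finsetSum _ fun b _ => (hx.integrable_mul_star _ b).const_mul _,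
      integral_const_mul, hx.cov]
    simp only [mul_apply, conjTranspose_apply, Finset.sum_mul]
    rw [Finset.sum_comm]
    exact Finset.sum_congr rfl fun a _ => Finset.sum_congr rfl fun b _ => by ring

lemma star_dotProduct_mulVec_eq_sum (M : Matrix (Fin n) (Fin n) ℂ) (v : Fin n → ℂ) :
    star v ⬝ᵥ M *ᵥ v = ∑ a, ∑ b, M a b * (v b * star (v a)) := by
  simp only [dotProduct, mulVec, Finset.mul_sum, Pi.star_apply]
  exact Finset.sum_congr rfl fun a _ => Finset.sum_congr rfl fun b _ => by ring

lemma IsCenteredWithCov.integrable_quadratic (hx : IsCenteredWithCov P A x)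
    (M : Matrix (Fin n) (Fin n) ℂ) :
    Integrable (fun s => star (x s).ofLp ⬝ᵥ M *ᵥ (x s).ofLp) P := by
  simp_rw [star_dotProduct_mulVec_eq_sum]
  exact integrable_finsetSum _ fun a _ => integrable_finsetSum _ fun b _ =>
    (hx.integrable_mul_star b a).const_mul _

lemma IsCenteredWithCov.integral_quadratic (hx : IsCenteredWithCov P A x)
    (M : Matrix (Fin n) (Fin n) ℂ) :
    ∫ s, (star (x s).ofLp ⬝ᵥ M *ᵥ (x s).ofLp).re ∂P = (M * A).trace.re := by
  have h1 := integral_re (hx.integrable_quadratic M)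
  simp only [RCLike.re_to_complex] at h1
  rw [h1]
  congr 1
  have hint : ∀ a b, Integrable (fun s => M a b * (x s b * star (x s a))) P := fun a b =>
    (hx.integrable_mul_star b a).const_mul _
  have h2 : ∀ s, star (x s).ofLp ⬝ᵥ M *ᵥ (x s).ofLp =
      ∑ a, ∑ b, M a b * (x s b * star (x s a)) := fun s => star_dotProduct_mulVec_eq_sum M _
  simp_rw [h2]
  rw [integral_finsetSum _ fun a _ => integrable_finsetSum _ fun b _ => hint a b]
  simp_rw [integral_finsetSum _ fun b _ => hint _ b, integral_const_mul, hx.cov]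
  simp only [trace, diag_apply, mul_apply]

lemma norm_sq_eq_re_star_dotProduct (v : EuclideanSpace ℂ (Fin n)) :
    ‖v‖ ^ 2 = (star v.ofLp ⬝ᵥ v.ofLp).re := by
  rw [EuclideanSpace.norm_sq_eq]
  simp only [dotProduct, Complex.re_sum]
  refine Finset.sum_congr rfl fun k _ => ?_
  rw [← Complex.normSq_eq_norm_sq, Complex.normSq_apply]
  simp

lemma IsCenteredWithCov.integral_norm_sq (hx : IsCenteredWithCov P A x) :
    ∫ s, ‖x s‖ ^ 2 ∂P = A.trace.re := by
  have h := hx.integral_quadratic 1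
  simp only [one_mulVec, one_mul] at h
  simp_rw [norm_sq_eq_re_star_dotProduct, h]

/-- Completing the square: the Young inequality associated with a positive definite matrix. -/
lemma two_mul_re_star_dotProduct_le {R : Matrix (Fin n) (Fin n) ℂ} (hR : R.PosDef)
    (v s : Fin n → ℂ) :
    2 * (star s ⬝ᵥ v).re ≤ (star v ⬝ᵥ R⁻¹ *ᵥ v).re + (star s ⬝ᵥ R *ᵥ s).re := by
  have hd := isUnit_det hR
  have h := (Complex.le_def.1 (hR.posSemidef.dotProduct_mulVec_nonneg (R⁻¹ *ᵥ v - s))).1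
  have e1 : R *ᵥ (R⁻¹ *ᵥ v - s) = v - R *ᵥ s := by
    rw [mulVec_sub, mulVec_mulVec, mul_nonsing_inv _ hd, one_mulVec]
  have e2 : star (R⁻¹ *ᵥ v) ⬝ᵥ v = star v ⬝ᵥ R⁻¹ *ᵥ v := by
    rw [star_mulVec, hR.inv.isHermitian.eq, dotProduct_mulVec]
  have e3 : star (R⁻¹ *ᵥ v) ⬝ᵥ R *ᵥ s = star v ⬝ᵥ s := by
    rw [star_mulVec, hR.inv.isHermitian.eq, ← dotProduct_mulVec, mulVec_mulVec,
      nonsing_inv_mul _ hd, one_mulVec]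
  have e4 : (star v ⬝ᵥ s).re = (star s ⬝ᵥ v).re := by
    rw [star_dotProduct, dotProduct_comm]; simp
  rw [e1, star_sub, sub_dotProduct, dotProduct_sub, dotProduct_sub, e2, e3] at h
  simp only [Complex.sub_re, Complex.zero_re, e4] at h
  linarith

/-- Young's inequality is applied to each `v j` against the sum `s` itself. Since the `R j` average
to 1, the terms in `s` add up to `‖s‖²`, half of the `2‖s‖²` on the left. -/
lemma norm_sq_weighted_sum_le {w : Fin m → ℝ} (hw : ∀ j, 0 < w j)
    {R : Fin m → Matrix (Fin n) (Fin n) ℂ} (hR : ∀ j, (R j).PosDef) (hR1 : ∑ j, w j • R j = 1)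
    (v : Fin m → EuclideanSpace ℂ (Fin n)) :
    ‖∑ j, (w j : ℂ) • v j‖ ^ 2 ≤
      ∑ j, w j * (star (v j).ofLp ⬝ᵥ (R j)⁻¹ *ᵥ (v j).ofLp).re := by
  set s := ∑ j, (w j : ℂ) • v j with hs
  have h1 : ∑ j, w j * (star s.ofLp ⬝ᵥ (v j).ofLp).re = ‖s‖ ^ 2 := by
    have h : ∀ t : Fin n → ℂ, (t ⬝ᵥ s.ofLp).re = ∑ j, w j * (t ⬝ᵥ (v j).ofLp).re := fun t => by
      rw [hs, WithLp.ofLp_sum, dotProduct_sum, Complex.re_sum]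
      exact Finset.sum_congr rfl fun j _ => by
        rw [WithLp.ofLp_smul, dotProduct_smul, smul_eq_mul, Complex.re_ofReal_mul]
    rw [norm_sq_eq_re_star_dotProduct, h]
  have h2 : ∑ j, w j * (star s.ofLp ⬝ᵥ R j *ᵥ s.ofLp).re = ‖s‖ ^ 2 := by
    have h : ∀ t : Fin n → ℂ, (t ⬝ᵥ (∑ j, w j • R j) *ᵥ s.ofLp).re =
        ∑ j, w j * (t ⬝ᵥ R j *ᵥ s.ofLp).re := fun t => by
      rw [sum_mulVec, dotProduct_sum, Complex.re_sum]
      exact Finset.sum_congr rfl fun j _ => by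
        rw [smul_mulVec, dotProduct_smul, Complex.smul_re, smul_eq_mul]
    rw [norm_sq_eq_re_star_dotProduct, ← h, hR1, one_mulVec]
  have h3 : ∑ j, w j * (2 * (star s.ofLp ⬝ᵥ (v j).ofLp).re) ≤
      ∑ j, w j * ((star (v j).ofLp ⬝ᵥ (R j)⁻¹ *ᵥ (v j).ofLp).re +
        (star s.ofLp ⬝ᵥ R j *ᵥ s.ofLp).re) :=
    Finset.sum_le_sum fun j _ => mul_le_mul_of_nonneg_left
      (two_mul_re_star_dotProduct_le (hR j) _ _) (hw j).le
  simp only [mul_add, Finset.sum_add_distrib, mul_left_comm _ (2 : ℝ), ← Finset.mul_sum] at h3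
  rw [h1, h2] at h3
  linarith

lemma weightedSumEnergy_le {w : Fin m → ℝ} (hw : ∀ j, 0 < w j)
    {R B : Fin m → Matrix (Fin n) (Fin n) ℂ} (hR : ∀ j, (R j).PosDef)
    (hR1 : ∑ j, w j • R j = 1) {y : Fin m → S → EuclideanSpace ℂ (Fin n)}
    (hy : ∀ j, IsCenteredWithCov P (B j) (y j)) :
    weightedSumEnergy P w y ≤ ∑ j, w j * ((R j)⁻¹ * B j).trace.re := by
  have hint : ∀ j, Integrable
      (fun s => w j * (star (y j s).ofLp ⬝ᵥ (R j)⁻¹ *ᵥ (y j s).ofLp).re) P := fun j =>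
    ((hy j).integrable_quadratic (R j)⁻¹).re.const_mul (w j)
  have hsum : MemLp (fun s => ∑ j, (w j : ℂ) • y j s) 2 P :=
    memLp_finsetSum _ fun j _ => (hy j).memLp.const_smul (w j : ℂ)
  calc weightedSumEnergy P w y
      ≤ ∫ s, ∑ j, w j * (star (y j s).ofLp ⬝ᵥ (R j)⁻¹ *ᵥ (y j s).ofLp).re ∂P :=
        integral_mono ((memLp_two_iff_integrable_sq_norm hsum.1).1 hsum)
          (integrable_finsetSum _ fun j _ => hint j)
          fun s => norm_sq_weighted_sum_le hw hR hR1 fun j => y j s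
    _ = _ := by
        rw [integral_finsetSum _ fun j _ => hint j]
        exact Finset.sum_congr rfl fun j _ => by
          rw [integral_const_mul, (hy j).integral_quadratic]

/-- The Rademacher vector of independent uniform signs. -/
noncomputable def signVector (n : ℕ) (s : ULift.{u} (Fin n → ℤˣ)) : EuclideanSpace ℂ (Fin n) :=
  WithLp.toLp 2 fun i => ((s.down i : ℤ) : ℂ)

/-- The uniform measure on sign vectors. -/
noncomputable def signMeasure (n : ℕ) : @Measure (ULift.{u} (Fin n → ℤˣ)) ⊤ :=
  @PMF.toMeasure _ ⊤ (PMF.uniformOfFintype (ULift.{u} (Fin n → ℤˣ)))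

lemma integral_signMeasure {E : Type*} [NormedAddCommGroup E] [NormedSpace ℝ E] [CompleteSpace E]
    (f : ULift.{u} (Fin n → ℤˣ) → E) :
    @integral _ E _ _ ⊤ (signMeasure n) f =
      (Fintype.card (ULift.{u} (Fin n → ℤˣ)) : ℝ)⁻¹ • ∑ s, f s := by
  let _ : MeasurableSpace (ULift.{u} (Fin n → ℤˣ)) := ⊤
  have : DiscreteMeasurableSpace (ULift.{u} (Fin n → ℤˣ)) := ⟨fun _ => trivial⟩
  rw [signMeasure, PMF.integral_eq_sum, Finset.smul_sum]
  simp

lemma isCenteredWithCov_signVector :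
    @IsCenteredWithCov n (ULift.{u} (Fin n → ℤˣ)) ⊤ (signMeasure n) 1 (signVector n) := by
  let _ : MeasurableSpace (ULift.{u} (Fin n → ℤˣ)) := ⊤
  have : DiscreteMeasurableSpace (ULift.{u} (Fin n → ℤˣ)) := ⟨fun _ => trivial⟩
  have : IsProbabilityMeasure (signMeasure.{u} n) := by
    unfold signMeasure; infer_instance
  refine ⟨.of_discrete, ?_, fun i k => ?_⟩
  -- Flipping all signs preserves the uniform measure and negates the vector.
  · have h := Equiv.sum_comp (Equiv.mulLeft (-1 : ULift.{u} (Fin n → ℤˣ))) (signVector n)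
    have hneg : ∀ s : ULift.{u} (Fin n → ℤˣ), signVector n (Equiv.mulLeft (-1) s) =
        -signVector n s := fun s => by
      ext i
      simp [signVector]
    simp only [hneg, Finset.sum_neg_distrib] at h
    have h2 : (2 : ℂ) • ∑ s, signVector.{u} n s = 0 := by
      rw [two_smul]
      nth_rw 1 [← h]
      exact neg_add_cancel _
    rw [integral_signMeasure, (smul_eq_zero.1 h2).resolve_left two_ne_zero, smul_zero]
  · rw [integral_signMeasure]
    by_cases hik : i = k
    · subst hik
      have h : ∀ s : ULift.{u} (Fin n → ℤˣ), signVector n s i * star (signVector n s i) = 1 :=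
        fun s => by
          rcases Int.units_eq_one_or (s.down i) with h | h <;> simp [signVector, h]
      simp only [h]
      simp
    -- Flipping only the sign at `i` negates the product of the coordinates `i ≠ k`.
    · have h := Equiv.sum_comp (Equiv.mulLeft
        (ULift.up (Pi.mulSingle i (-1)) : ULift.{u} (Fin n → ℤˣ)))
        fun s => signVector n s i * star (signVector n s k)
      have hneg : ∀ s : ULift.{u} (Fin n → ℤˣ),
          signVector n (Equiv.mulLeft (ULift.up (Pi.mulSingle i (-1))) s) i *
            star (signVector n (Equiv.mulLeft (ULift.up (Pi.mulSingle i (-1))) s) k) =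
          -(signVector n s i * star (signVector n s k)) := fun s => by
        simp [signVector, Pi.mulSingle_eq_of_ne (Ne.symm hik)]
      simp only [hneg, Finset.sum_neg_distrib] at h
      rw [self_eq_neg.1 h.symm, smul_zero, one_apply_ne hik]

end MCoupling

/-! ### The barycentre and the optimal coupling -/

namespace MCoupling

open Matrix

variable {n m : ℕ} {w : Fin m → ℝ} {A : Fin m → Matrix (Fin n) (Fin n) ℂ}

/-- The square root of `B` applied to a vector of independent signs. Attainment of the maximum needs
at least one such vector, in any universe. -/
lemma exists_isCenteredWithCov {B : Matrix (Fin n) (Fin n) ℂ} (hB : B.PosDef) :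
    ∃ (S : Type u) (_ : MeasurableSpace S) (P : Measure S), IsProbabilityMeasure P ∧
      ∃ x : S → EuclideanSpace ℂ (Fin n), IsCenteredWithCov P B x := by
  let _ : MeasurableSpace (ULift.{u} (Fin n → ℤˣ)) := ⊤
  have : IsProbabilityMeasure (signMeasure.{u} n) := by
    unfold signMeasure; infer_instance
  have h := (isCenteredWithCov_signVector.{u} (n := n)).toEuclideanLin (CFC.sqrt B)
  rw [mul_one, (posDef_sqrt hB).isHermitian.eq, sqrt_mul_sqrt hB] at h
  exact ⟨_, _, _, this, _, h⟩

lemma isWassersteinBarycenter_iff [NeZero m] (hw : ∀ j, 0 < w j) (hw1 : ∑ j, w j = 1)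
    (hA : ∀ j, (A j).PosDef) (X : Matrix (Fin n) (Fin n) ℂ) :
    IsWassersteinBarycenter w A X ↔ X = wassersteinBarycenter w A := by
  obtain ⟨X₀, hX₀, h1⟩ := exists_meanTransport_eq_one hw hw1 hA
  have h0 := isWassersteinBarycenter_of_meanTransport_eq_one hw hw1 hA hX₀ h1
  have hΩ : IsWassersteinBarycenter w A (wassersteinBarycenter w A) :=
    Classical.epsilon_spec ⟨X₀, h0⟩
  refine ⟨fun hX => ?_, fun hX => hX ▸ hΩ⟩
  rw [hX.eq_of_meanTransport_eq_one hw hw1 hA hX₀ h1,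
    hΩ.eq_of_meanTransport_eq_one hw hw1 hA hX₀ h1]

lemma wassersteinBarycenter_spec [NeZero m] (hw : ∀ j, 0 < w j) (hw1 : ∑ j, w j = 1)
    (hA : ∀ j, (A j).PosDef) : (wassersteinBarycenter w A).PosDef ∧
      meanTransport w A (wassersteinBarycenter w A) = 1 := by
  obtain ⟨X₀, hX₀, h1⟩ := exists_meanTransport_eq_one hw hw1 hA
  have h0 := isWassersteinBarycenter_of_meanTransport_eq_one hw hw1 hA hX₀ h1
  rw [← (isWassersteinBarycenter_iff hw hw1 hA X₀).1 h0]
  exact ⟨hX₀, h1⟩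

lemma optimal_coupling [NeZero m] (hw : ∀ j, 0 < w j) (hw1 : ∑ j, w j = 1)
    (hA : ∀ j, (A j).PosDef) {S : Type*} [MeasurableSpace S] {P : Measure S}
    [IsProbabilityMeasure P] {x₁ : S → EuclideanSpace ℂ (Fin n)}
    (hx₁ : IsCenteredWithCov P (A 0) x₁) {x : Fin m → S → EuclideanSpace ℂ (Fin n)}
    (hx : ∀ j s, x j s =
      Matrix.toEuclideanLin (transportFactor w A j * (transportFactor w A 0)⁻¹) (x₁ s)) :
    x 0 = x₁ ∧ (∀ j, IsCenteredWithCov P (A j) (x j)) ∧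
      weightedSumEnergy P w x = (wassersteinBarycenter w A).trace.re := by
  obtain ⟨hΩ, hT⟩ := wassersteinBarycenter_spec hw hw1 hA
  have hR : ∀ j, (transportFactor w A j).PosDef := fun j => posDef_geometricMean hΩ.inv (hA j)
  have hRA : ∀ j, transportFactor w A j * wassersteinBarycenter w A * transportFactor w A j =
    A j := fun j => geometricMean_inv_mul_mul hΩ (hA j)
  have hsum : ∑ j, w j • transportFactor w A j = 1 := hT
  have hd := isUnit_det (hR 0)
  -- This is the covariance of `R_1⁻¹ x_1`: every `x_j` is `R_j` applied to this single vector with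
  -- covariance `Ω`.
  have hΩ0 : (transportFactor w A 0)⁻¹ * A 0 * ((transportFactor w A 0)⁻¹)ᴴ =
      wassersteinBarycenter w A := by
    rw [(hR 0).inv.isHermitian.eq, ← hRA 0]
    generalize transportFactor w A 0 = R at hd
    calc R⁻¹ * (R * wassersteinBarycenter w A * R) * R⁻¹
        = (R⁻¹ * R) * wassersteinBarycenter w A * (R * R⁻¹) := by simp only [mul_assoc]
      _ = wassersteinBarycenter w A := by
        rw [nonsing_inv_mul _ hd, mul_nonsing_inv _ hd, one_mul, mul_one]
  refine ⟨?_, fun j => ?_, ?_⟩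
  · funext s
    rw [hx, mul_nonsing_inv _ hd]
    simp
  · have h := hx₁.toEuclideanLin (transportFactor w A j * (transportFactor w A 0)⁻¹)
    have e : transportFactor w A j * (transportFactor w A 0)⁻¹ * A 0 *
        (transportFactor w A j * (transportFactor w A 0)⁻¹)ᴴ = A j := by
      rw [conjTranspose_mul, (hR j).isHermitian.eq]
      calc transportFactor w A j * (transportFactor w A 0)⁻¹ * A 0 *
            (((transportFactor w A 0)⁻¹)ᴴ * transportFactor w A j)
          = transportFactor w A j * ((transportFactor w A 0)⁻¹ * A 0 *
            ((transportFactor w A 0)⁻¹)ᴴ) * transportFactor w A j := by simp only [mul_assoc]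
        _ = A j := by rw [hΩ0, hRA]
    rw [e] at h
    exact (funext (hx j) : x j = _) ▸ h
  · have h := hx₁.toEuclideanLin (transportFactor w A 0)⁻¹
    rw [hΩ0] at h
    rw [← h.integral_norm_sq, weightedSumEnergy]
    congr 1
    funext s
    have e : ∑ j, (w j : ℂ) • x j s =
        Matrix.toEuclideanLin (∑ j, w j • transportFactor w A j)
          (Matrix.toEuclideanLin (transportFactor w A 0)⁻¹ (x₁ s)) := by
      simp_rw [hx, map_sum, LinearMap.sum_apply]
      refine Finset.sum_congr rfl fun j _ => ?_
      rw [← Complex.coe_smul, map_smul, LinearMap.smul_apply]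
      simp [toLpLin_apply, mulVec_mulVec]
    rw [e, hsum]
    simp [toLpLin_apply]

end MCoupling

theorem mainTheorem11 (n m : ℕ) [NeZero m]
    (w : Fin m → ℝ) (hw : ∀ j, 0 < w j) (hw1 : ∑ j, w j = 1)
    (A : Fin m → Matrix (Fin n) (Fin n) ℂ) (hA : ∀ j, (A j).PosDef) :
    -- the barycentre is the unique minimiser
    (∀ X : Matrix (Fin n) (Fin n) ℂ, MCoupling.IsWassersteinBarycenter w A X ↔
      X = MCoupling.wassersteinBarycenter w A) ∧
    -- the value of the maximum over all couplings
    IsGreatest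
      {v : ℝ | ∃ (S : Type u) (_ : MeasurableSpace S) (P : Measure S),
        IsProbabilityMeasure P ∧
        ∃ x : Fin m → S → EuclideanSpace ℂ (Fin n),
          (∀ j, MCoupling.IsCenteredWithCov P (A j) (x j)) ∧
          v = MCoupling.weightedSumEnergy P w x}
      (MCoupling.wassersteinBarycenter w A).trace.re ∧
    -- the maximum is attained at every tuple `x_j = R_j R_1⁻¹ x_1`
    (∀ (S : Type u) [MeasurableSpace S] (P : Measure S) [IsProbabilityMeasure P]
      (x₁ : S → EuclideanSpace ℂ (Fin n)), MCoupling.IsCenteredWithCov P (A 0) x₁ →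
      ∀ x : Fin m → S → EuclideanSpace ℂ (Fin n),
        (∀ j s, x j s = Matrix.toEuclideanLin
          (MCoupling.transportFactor w A j * (MCoupling.transportFactor w A 0)⁻¹) (x₁ s)) →
        x 0 = x₁ ∧
        (∀ j, MCoupling.IsCenteredWithCov P (A j) (x j)) ∧
        MCoupling.weightedSumEnergy P w x = (MCoupling.wassersteinBarycenter w A).trace.re) := by

  obtain ⟨hΩ, hT⟩ := MCoupling.wassersteinBarycenter_spec hw hw1 hA
  refine ⟨MCoupling.isWassersteinBarycenter_iff hw hw1 hA, ⟨?_, ?_⟩, ?_⟩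
  · obtain ⟨S, _, P, hP, x₁, hx₁⟩ := MCoupling.exists_isCenteredWithCov.{u} (hA 0)
    have h := MCoupling.optimal_coupling hw hw1 hA hx₁ fun _ _ => rfl
    exact ⟨S, _, P, hP, _, h.2.1, h.2.2.symm⟩
  · rintro _ ⟨S, _, P, hP, x, hx, rfl⟩
    have hR := fun j => MCoupling.posDef_geometricMean hΩ.inv (hA j)
    refine (MCoupling.weightedSumEnergy_le hw hR hT hx).trans_eq ?_
    have h := MCoupling.trace_sum_smul_mul_re w
      (fun j => MCoupling.geometricMean (MCoupling.wassersteinBarycenter w A)⁻¹ (A j))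
      (MCoupling.wassersteinBarycenter w A)
    rw [← MCoupling.meanTransport, hT, one_mul] at h
    rw [h]
    refine Finset.sum_congr rfl fun j _ => ?_
    -- Both terms of the dual formula equal the fidelity at the optimum, so `tr(R_j⁻¹ A_j) = tr(R_j
    -- Ω)`.
    have h1 := MCoupling.two_mul_fidelity_eq hΩ (hA j)
    rw [MCoupling.fidelity_eq_trace hΩ] at h1
    congr 1
    linarith
  · intro S _ P _ x₁ hx₁ x hx
    exact MCoupling.optimal_coupling hw hw1 hA hx₁ hx
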